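/- **Setting.** Let $a=\{a_n\}_{n\ge 0}$ and $b=\{b_n\}_{n\ge 0}$ be sequences of non-zero complex numbers, and put $f_n(z)=(a_n+b_nz)z^n$ for $z$ in the open unit disc $\mathbb{D}$ and $n\ge 0$. Assume that, for each fixed $w\in\mathbb{D}$, the kernel $$k(z,w)=\sum_{n\ge 0}f_n(z)\overline{f_n(w)}=|a_0|^2+\sum_{n\ge1}(|a_n|^2+|b_{n-1}|^2)z^n\overline{w}^n+\sum_{n\ge0}a_n\overline{b_n}z^n\overline{w}^{n+1}+\sum_{n\ge0}\overline{a_n}b_nz^{n+1}\overline{w}^n,$$ regarded as a power series in $z$, has radius of convergence at least $1$. Let $\mathcal{H}_{a,b}$ be the Hilbert space of functions on $\mathbb{D}$ that has $\{f_n\}_{n\ge0}$ as an orthonormal basis, that is, the space of all $\sum_n \lambda_n f_n$ with $(\lambda_n)\in\ell^2$, with the norm $\|\sum_n\lambda_nf_n\|=\|(\lambda_n)\|_{\ell^2}$; its elements are analytic on $\mathbb{D}$. The backward shift $B$ on $\mathcal{H}_{a,b}$ is given by $B\left(\sum_{n\ge0}\lambda_nz^n\right)=\sum_{n\ge0}\lambda_{n+1}z^n$.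 For a bounded operator $T$, the essential spectrum $\sigma_e(T)$ is the set of all $\lambda\in\mathbb{C}$ such that $T-\lambda I$ is not Fredholm (an operator is Fredholm if its range is closed and its kernel and cokernel are finite dimensional). **Theorem.** Assume that $$\sup_n\left|\frac{a_{n+1}}{a_n}\right|<\infty,\qquad \limsup_n\left|\frac{b_n}{a_{n+1}}\right|<1,\qquad \lim_n\left|\frac{b_n}{a_n}-\frac{b_{n-1}}{a_{n-1}}\right|=0 .$$ Then $B$ is a bounded operator on $\mathcal{H}_{a,b}$, and the following hold. (i) $B$ is unitarily equivalent to $B_w+K$ on $\ell^2=\ell^2(\{0,1,2,\dots\})$, where $K$ is a compact operator and $B_w$ is the bounded weighted backward shift $B_we_0=0$, $B_we_n=w_ne_{n-1}$ $(n\ge1)$ with weights $w_n=a_n/a_{n-1}$, $n\geq 1$. (ii) The essential spectrum $\sigma_e(B)$ is the (possibly degenerate) annulus $$\left\{z\in\mathbb{C}:\ \sup_{n\ge1}\left(\inf_{k\ge1}\left|\frac{a_{k+n}}{a_k}\right|\right)^{1/n}\le|z|\le\inf_{n\ge1}\left(\sup_{k\ge1}\left|\frac{a_{k+n}}{a_k}\right|\right)^{1/n}\right\}.$$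 -/

import Mathlib

open Filter Topology Complex.UnitDisc
open scoped ENNReal NNReal ComplexConjugate

noncomputable section

/-- The functions `f_n(z) = (a_n + b_n z) z^n` on the open unit disc. -/
def tridiagFun (a b : ℕ → ℂ) (n : ℕ) (z : 𝔻) : ℂ := (a n + b n * z) * (z : ℂ) ^ n

/-- The coefficient of `z^n` in the tridiagonal kernel
`k(z,w) = ∑ f_n(z) conj (f_n(w))`, for fixed `w`. -/
def kernelCoeff (a b : ℕ → ℂ) (w : 𝔻) : ℕ → ℂ
  | 0 => (‖a 0‖ : ℂ) ^ 2 + a 0 * conj (b 0) * conj (w : ℂ)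
  | n + 1 => ((‖a (n + 1)‖ : ℂ) ^ 2 + (‖b n‖ : ℂ) ^ 2) * conj (w : ℂ) ^ (n + 1)
      + a (n + 1) * conj (b (n + 1)) * conj (w : ℂ) ^ (n + 2)
      + conj (a n) * b n * conj (w : ℂ) ^ n

/-- The standing assumptions on the data of a tridiagonal space: two sequences of nonzero complex
numbers such that, for each fixed `w` in the disc, the power series of `k(·, w)` converges on the
whole open unit disc. -/
structure IsTridiagonalPair (a b : ℕ → ℂ) : Prop where
  a_ne_zero : ∀ n, a n ≠ 0
  b_ne_zero : ∀ n, b n ≠ 0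
  one_le_radius : ∀ w : 𝔻,
    1 ≤ (FormalMultilinearSeries.ofScalars ℂ (kernelCoeff a b w)).radius

/-- The Hilbert space `ℓ²` of square summable complex sequences indexed by `0, 1, 2, …`. -/
abbrev SeqL2 : Type := lp (fun _ : ℕ => ℂ) 2

namespace IsTridiagonalPair

variable {a b : ℕ → ℂ}

lemma summable_kernel_diag (h : IsTridiagonalPair a b) {r : ℝ} (hr0 : 0 < r) (hr1 : r < 1) :
    Summable fun n => (‖a (n + 1)‖ ^ 2 + ‖b n‖ ^ 2) * (r ^ 2) ^ (n + 1) := by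
  have key : ∀ w : 𝔻, Summable fun n => ‖kernelCoeff a b w n‖ * r ^ n := by
    intro w
    have h1 := (FormalMultilinearSeries.ofScalars ℂ (kernelCoeff a b w)).summable_norm_mul_pow
      (r := r.toNNReal) (lt_of_lt_of_le (by exact_mod_cast Real.toNNReal_lt_one.2 hr1)
        (h.one_le_radius w))
    simpa [FormalMultilinearSeries.ofScalars_norm, Real.coe_toNNReal r hr0.le] using h1
  let w₁ : 𝔻 := Complex.UnitDisc.mk (r : ℂ) (by simpa [abs_of_pos hr0] using hr1)
  let w₂ : 𝔻 := Complex.UnitDisc.mk (-r : ℂ) (by simpa [abs_of_pos hr0] using hr1)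
  have h1 := (summable_nat_add_iff 1).2 (key w₁)
  have h2 := (summable_nat_add_iff 1).2 (key w₂)
  refine Summable.of_nonneg_of_le (fun n => by positivity) (fun n => ?_) (h1.add h2)
  have e : 2 * (((‖a (n + 1)‖ : ℂ) ^ 2 + (‖b n‖ : ℂ) ^ 2) * (r : ℂ) ^ (n + 1))
      = kernelCoeff a b w₁ (n + 1) + (-1) ^ (n + 1) * kernelCoeff a b w₂ (n + 1) := by
    have e1 : ((-1 : ℂ)) ^ n * (-1) ^ n = 1 := by rw [← mul_pow]; simp
    simp only [kernelCoeff, w₁, w₂, Complex.UnitDisc.coe_mk, map_neg, Complex.conj_ofReal]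
    simp only [neg_pow (r : ℂ), pow_succ (-1 : ℂ)]
    linear_combination (-(((‖a (n + 1)‖ : ℂ) ^ 2 + (‖b n‖ : ℂ) ^ 2) * (r : ℂ) ^ (n + 1))
      + a (n + 1) * conj (b (n + 1)) * (r : ℂ) ^ (n + 2)
      + conj (a n) * b n * (r : ℂ) ^ n) * e1
  have e2 : 2 * ((‖a (n + 1)‖ ^ 2 + ‖b n‖ ^ 2) * r ^ (n + 1))
      ≤ ‖kernelCoeff a b w₁ (n + 1)‖ + ‖kernelCoeff a b w₂ (n + 1)‖ := by
    have e3 := congrArg norm e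
    have e4 : ‖2 * (((‖a (n + 1)‖ : ℂ) ^ 2 + (‖b n‖ : ℂ) ^ 2) * (r : ℂ) ^ (n + 1))‖
        = 2 * ((‖a (n + 1)‖ ^ 2 + ‖b n‖ ^ 2) * r ^ (n + 1)) := by
      rw [← abs_of_nonneg (show 0 ≤ 2 * ((‖a (n + 1)‖ ^ 2 + ‖b n‖ ^ 2) * r ^ (n + 1)) by positivity),
        ← Real.norm_eq_abs, ← Complex.norm_real]
      push_cast
      rfl
    rw [← e4, e3]
    refine (norm_add_le _ _).trans ?_
    simp
  have hp : 0 ≤ (‖a (n + 1)‖ ^ 2 + ‖b n‖ ^ 2) * r ^ (n + 1) := by positivity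
  have hq : 0 < r ^ (n + 1) := by positivity
  calc (‖a (n + 1)‖ ^ 2 + ‖b n‖ ^ 2) * (r ^ 2) ^ (n + 1)
      = ((‖a (n + 1)‖ ^ 2 + ‖b n‖ ^ 2) * r ^ (n + 1)) * r ^ (n + 1) := by ring
    _ ≤ (‖kernelCoeff a b w₁ (n + 1)‖ + ‖kernelCoeff a b w₂ (n + 1)‖) * r ^ (n + 1) := by
        gcongr; linarith
    _ = _ := by ring

lemma summable_sq_a (h : IsTridiagonalPair a b) (z : 𝔻) :
    Summable fun n => ‖a n * (z : ℂ) ^ n‖ ^ 2 := by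
  obtain ⟨r, h1, h2⟩ := exists_between z.norm_lt_one
  have h0 : 0 < r := (norm_nonneg _).trans_lt h1
  refine (summable_nat_add_iff 1).1 (Summable.of_nonneg_of_le (fun n => by positivity)
    (fun n => ?_) (h.summable_kernel_diag h0 h2))
  rw [norm_mul, mul_pow, norm_pow, ← pow_mul, mul_comm (n + 1) 2, pow_mul]
  gcongr
  nlinarith [sq_nonneg ‖b n‖]

lemma summable_sq_b (h : IsTridiagonalPair a b) (z : 𝔻) :
    Summable fun n => ‖b n * (z : ℂ) ^ (n + 1)‖ ^ 2 := by
  obtain ⟨r, h1, h2⟩ := exists_between z.norm_lt_one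
  have h0 : 0 < r := (norm_nonneg _).trans_lt h1
  refine Summable.of_nonneg_of_le (fun n => by positivity)
    (fun n => ?_) (h.summable_kernel_diag h0 h2)
  rw [norm_mul, mul_pow, norm_pow, ← pow_mul, mul_comm (n + 1) 2, pow_mul]
  gcongr
  nlinarith [sq_nonneg ‖a (n + 1)‖]

lemma summable_l2_mul (c : SeqL2) {g : ℕ → ℂ} (hg : Summable fun n => ‖g n‖ ^ 2) :
    Summable fun n => c n * g n := by
  have hc : Summable fun n => ‖c n‖ ^ 2 := by
    have := (lp.memℓp c).summable (by norm_num)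
    simpa using this
  refine Summable.of_norm_bounded (hc.add hg) (fun n => ?_)
  rw [norm_mul]
  nlinarith [sq_nonneg (‖c n‖ - ‖g n‖), sq_nonneg ‖c n‖, sq_nonneg ‖g n‖]

lemma summable_a (h : IsTridiagonalPair a b) (c : SeqL2) (z : 𝔻) :
    Summable fun n => c n * (a n * (z : ℂ) ^ n) := summable_l2_mul c (h.summable_sq_a z)

lemma summable_b (h : IsTridiagonalPair a b) (c : SeqL2) (z : 𝔻) :
    Summable fun n => c n * (b n * (z : ℂ) ^ (n + 1)) := summable_l2_mul c (h.summable_sq_b z)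

lemma summable_tridiagFun (h : IsTridiagonalPair a b) (c : SeqL2) (z : 𝔻) :
    Summable fun n => c n * tridiagFun a b n z := by
  refine ((h.summable_a c z).add (h.summable_b c z)).congr (fun n => ?_)
  simp only [tridiagFun]; ring

/-- The linear map that sends a square summable sequence `c` to the function `∑ c_n f_n`
on the unit disc. -/
def synthesis (h : IsTridiagonalPair a b) : SeqL2 →ₗ[ℂ] (𝔻 → ℂ) where
  toFun c z := ∑' n, c n * tridiagFun a b n z
  map_add' c d := by
    ext z
    simp only [lp.coeFn_add, Pi.add_apply, add_mul]
    exact (h.summable_tridiagFun c z).tsum_add (h.summable_tridiagFun d z)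
  map_smul' t c := by
    ext z
    simp only [lp.coeFn_smul, Pi.smul_apply, smul_eq_mul, mul_assoc, RingHom.id_apply, tsum_mul_left]

lemma hasSum_synthesis (h : IsTridiagonalPair a b) (c : SeqL2) (z : 𝔻) :
    HasSum (fun n => c n * tridiagFun a b n z) (h.synthesis c z) :=
  (h.summable_tridiagFun c z).hasSum

/-- The Taylor coefficients of `∑ c_n f_n`. -/
def taylorSeq (a b c : ℕ → ℂ) : ℕ → ℂ
  | 0 => c 0 * a 0
  | n + 1 => c (n + 1) * a (n + 1) + c n * b n

lemma hasSum_taylorSeq (h : IsTridiagonalPair a b) (c : SeqL2) (z : 𝔻) :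
    HasSum (fun n => taylorSeq a b c n * (z : ℂ) ^ n) (h.synthesis c z) := by
  have hA := h.summable_a c z
  have hB := h.summable_b c z
  have hA' := (summable_nat_add_iff 1).2 hA
  have hs : Summable fun n => taylorSeq a b c n * (z : ℂ) ^ n := by
    refine (summable_nat_add_iff 1).1 ((hA'.add hB).congr fun n => ?_)
    simp only [taylorSeq]; ring
  have e : ∑' n, taylorSeq a b c n * (z : ℂ) ^ n = h.synthesis c z := by
    have e1 : h.synthesis c z
        = ∑' n, (c n * (a n * (z : ℂ) ^ n) + c n * (b n * (z : ℂ) ^ (n + 1))) :=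
      tsum_congr fun n => by simp only [tridiagFun]; ring
    rw [e1, hA.tsum_add hB, hA.tsum_eq_zero_add, hs.tsum_eq_zero_add, add_assoc,
      ← hA'.tsum_add hB]
    congr 1
    · simp [taylorSeq]
    · exact tsum_congr fun n => by simp only [taylorSeq]; ring
  exact e ▸ hs.hasSum

lemma eq_zero_of_hasSum_zero {d : ℕ → ℂ} (hd : ∀ z : 𝔻, HasSum (fun n => d n * (z : ℂ) ^ n) 0) :
    ∀ n, d n = 0 := by
  have hr : 1 ≤ (FormalMultilinearSeries.ofScalars ℂ d).radius := by
    refine ENNReal.le_of_forall_nnreal_lt fun r hr => ?_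
    have hr' : (r : ℝ) < 1 := by exact_mod_cast hr
    refine FormalMultilinearSeries.le_radius_of_tendsto _ (l := 0) ?_
    have := (hd (Complex.UnitDisc.mk ((r : ℝ) : ℂ) (by simpa using hr'))).summable.tendsto_atTop_zero
    simpa [FormalMultilinearSeries.ofScalars_norm] using this.norm
  have hp : HasFPowerSeriesOnBall (fun _ : ℂ => (0 : ℂ))
      (FormalMultilinearSeries.ofScalars ℂ d) 0 1 := by
    refine ⟨hr, one_pos, fun {y} hy => ?_⟩
    have hy' : ‖y‖ < 1 := by
      rw [Metric.mem_eball, edist_zero_right] at hy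
      rw [← ofReal_norm, ENNReal.ofReal_lt_one] at hy
      exact hy
    have := hd (Complex.UnitDisc.mk y hy')
    simpa [FormalMultilinearSeries.ofScalars_apply_eq, mul_comm] using this
  have hz := hp.hasFPowerSeriesAt.eq_zero
  exact fun n => (FormalMultilinearSeries.ofScalars_eq_zero (E := ℂ) (c := d) n).1 (by rw [hz]; rfl)

lemma synthesis_injective (h : IsTridiagonalPair a b) : Function.Injective h.synthesis := by
  refine (injective_iff_map_eq_zero _).2 fun c hc => ?_
  have hd : ∀ n, taylorSeq a b c n = 0 := eq_zero_of_hasSum_zero fun z => by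
    have := h.hasSum_taylorSeq c z
    rwa [hc] at this
  ext n
  induction n with
  | zero => simpa [taylorSeq, h.a_ne_zero] using hd 0
  | succ n ih =>
    have ih' : c n = 0 := ih
    simpa [taylorSeq, h.a_ne_zero, ih'] using hd (n + 1)

end IsTridiagonalPair

/-- The tridiagonal space `H_{a,b}`: all functions `∑ c_n f_n` on the unit disc with `c` square
summable. It carries the norm and the inner product for which `c ↦ ∑ c_n f_n` is unitary (see
below), so that `(f_n)` is an orthonormal basis. -/
def TridiagonalSpace {a b : ℕ → ℂ} (h : IsTridiagonalPair a b) : Type :=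
  LinearMap.range h.synthesis

namespace TridiagonalSpace

variable {a b : ℕ → ℂ} (h : IsTridiagonalPair a b)

instance instAddCommGroup : AddCommGroup (TridiagonalSpace h) :=
  inferInstanceAs (AddCommGroup (LinearMap.range h.synthesis))

instance instModule : Module ℂ (TridiagonalSpace h) :=
  inferInstanceAs (Module ℂ (LinearMap.range h.synthesis))

/-- The elements of `H_{a,b}` are functions on the unit disc. -/
instance instFunLike : FunLike (TridiagonalSpace h) 𝔻 ℂ where
  coe f := Subtype.val (p := fun g => g ∈ LinearMap.range h.synthesis) f
  coe_injective := Subtype.val_injective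

/-- The bijection `∑ c_n f_n ↦ c` between `H_{a,b}` and `ℓ²`. -/
def coordEquiv : TridiagonalSpace h ≃ₗ[ℂ] SeqL2 :=
  (LinearEquiv.ofInjective h.synthesis h.synthesis_injective).symm

instance instNormedAddCommGroup : NormedAddCommGroup (TridiagonalSpace h) :=
  NormedAddCommGroup.induced (TridiagonalSpace h) SeqL2 (coordEquiv h) (coordEquiv h).injective

instance instInnerProductSpace : InnerProductSpace ℂ (TridiagonalSpace h) :=
  InnerProductSpace.induced (𝕜 := ℂ) (E := SeqL2) (coordEquiv h)

/-- `(f_n)` as an orthonormal basis of `H_{a,b}`; see `basis_apply`. -/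
def basis : HilbertBasis ℕ ℂ (TridiagonalSpace h) :=
  HilbertBasis.ofRepr ⟨coordEquiv h, fun _ => rfl⟩

instance instCompleteSpace : CompleteSpace (TridiagonalSpace h) :=
  (completeSpace_congr (e := (basis h).repr.toEquiv)
    (basis h).repr.isometry.isUniformEmbedding).2 inferInstance

lemma basis_apply (n : ℕ) (z : 𝔻) : basis h n z = (a n + b n * z) * (z : ℂ) ^ n := by
  classical
  have e : basis h n = (coordEquiv h).symm (lp.single 2 n 1) := by
    rw [← HilbertBasis.repr_symm_single]; rfl
  have e2 : basis h n z = h.synthesis (lp.single 2 n 1) z := by rw [e]; rfl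
  rw [e2, ← (h.hasSum_synthesis _ z).tsum_eq, tsum_eq_single n]
  · simp [tridiagFun]
  · intro m hm
    simp [hm]

end TridiagonalSpace

/-- `g` is the coefficient backward shift of `f`: for some (necessarily unique) sequence `c`,
`f(z) = ∑ c_n z^n` and `g(z) = ∑ c_{n+1} z^n` on the unit disc. -/
def IsCoeffBackwardShift (f g : 𝔻 → ℂ) : Prop :=
  ∃ c : ℕ → ℂ, (∀ z : 𝔻, HasSum (fun n => c n * (z : ℂ) ^ n) (f z)) ∧
    ∀ z : 𝔻, HasSum (fun n => c (n + 1) * (z : ℂ) ^ n) (g z)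

/-- `T` is the weighted backward shift on `ℓ²` with weights `w_1, w_2, …` (the value `w 0` is not
used): `T e_0 = 0` and `T e_n = w_n e_{n-1}` for `n ≥ 1`, in coordinates. -/
def IsWeightedBackwardShift (w : ℕ → ℂ) (T : SeqL2 →L[ℂ] SeqL2) : Prop :=
  ∀ (x : SeqL2) (n : ℕ), T x n = w (n + 1) * x (n + 1)

/-- The essential spectrum: all `μ` for which `T - μ I` is not Fredholm. -/
def essentialSpectrum {H : Type*} [NormedAddCommGroup H] [InnerProductSpace ℂ H]
    (T : H →L[ℂ] H) : Set ℂ :=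
  {μ : ℂ | ¬ (T - μ • ContinuousLinearMap.id ℂ H).IsFredholm}

end

/-! In the coordinates of the basis `(f_n)`, write the image of `c` under the backward shift as `T c
+ y`, with `T` the weighted shift of weights `a n / a (n - 1)`. Comparing Taylor coefficients gives
`(1 + F) y = D c`, where `F` is the forward shift with weights `b n / a (n + 1)` and `D` is diagonal
with entries tending to `0`. The limsup condition makes `1 + F` invertible, so `K = (1 + F)⁻¹ D` is
a norm limit of finite rank operators. This gives (i), and reduces (ii) to `T`, because Fredholmness
is stable under such perturbations.

For `T - μ`, one inclusion comes from Neumann series. If `|μ|^n` exceeds every `n`-step ratio `|a (k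
+ n) / a k|` with `k ≥ 1`, strictly and uniformly, then `T - μ` is invertible modulo finite rank. If
it lies uniformly below them, the same argument applies to a weighted forward shift that inverts `T`
modulo finite rank (`isFredholm_sub_of_le`, `isFredholm_sub_of_ge`).

Conversely, a Fredholm `T - μ` has closed range containing every basis vector, so it is onto with
norm control on preimages. For `μ ≠ 0`, pairing with the sequence `a j / μ ^ j` telescopes, and its
square sums over intervals are bounded by its end point values. By `geometric_dichotomy` it then
decays or grows geometrically, uniformly in the starting point, which puts `|μ|` strictly outside
the annulus. -/

/-! ### Fredholm operators and their stability under perturbation -/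

open LinearMap.FiniteRangeSetoid in
lemma ContinuousLinearMap.isFredholm_of_left_right {H : Type*} [NormedAddCommGroup H]
    [NormedSpace ℂ H] {u v₁ v₂ : H →L[ℂ] H}
    (h₁ : ((v₁ * u - 1 : H →L[ℂ] H) : H →ₗ[ℂ] H).HasFiniteRange)
    (h₂ : ((u * v₂ - 1 : H →L[ℂ] H) : H →ₗ[ℂ] H).HasFiniteRange) : u.IsFredholm := by
  refine .of_isQuasiInverse (v := v₁) ⟨?_, ?_⟩
  · exact equiv_iff_hasFiniteRange.2 h₁
  · refine equiv_iff_hasFiniteRange.2 ?_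
    -- Left and right inverses modulo finite rank agree modulo finite rank, so `v₁` also works on
    -- the right.
    have e : ((u : H →ₗ[ℂ] H) ∘ₗ (v₁ : H →ₗ[ℂ] H) - .id)
        = ((u * v₂ - 1 : H →L[ℂ] H) : H →ₗ[ℂ] H)
          - (u : H →ₗ[ℂ] H) ∘ₗ
            (v₁ : H →ₗ[ℂ] H) ∘ₗ ((u * v₂ - 1 : H →L[ℂ] H) : H →ₗ[ℂ] H)
          + (u : H →ₗ[ℂ] H) ∘ₗ
            ((v₁ * u - 1 : H →L[ℂ] H) : H →ₗ[ℂ] H) ∘ₗ (v₂ : H →ₗ[ℂ] H) := by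
      ext x
      simp
      abel
    rw [e]
    exact (h₂.sub ((h₂.comp_left _).comp_left _)).add ((h₁.comp_right _).comp_left _)

lemma ContinuousLinearMap.IsFredholm.exists_hasFiniteRange {H : Type*} [NormedAddCommGroup H]
    [NormedSpace ℂ H] {u : H →L[ℂ] H} (hu : u.IsFredholm) :
    ∃ v : H →L[ℂ] H, ((v * u - 1 : H →L[ℂ] H) : H →ₗ[ℂ] H).HasFiniteRange ∧
      ((u * v - 1 : H →L[ℂ] H) : H →ₗ[ℂ] H).HasFiniteRange := by
  obtain ⟨v, h₁, h₂⟩ := hu.exists_isQuasiInverse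
  exact ⟨v, LinearMap.FiniteRangeSetoid.equiv_iff_hasFiniteRange.1 h₁,
    LinearMap.FiniteRangeSetoid.equiv_iff_hasFiniteRange.1 h₂⟩

/-- An operator is finite rank approximable if it is a norm limit of finite rank operators. -/
def ContinuousLinearMap.FiniteRankApproximable {H : Type*} [NormedAddCommGroup H]
    [NormedSpace ℂ H] (K : H →L[ℂ] H) : Prop :=
  ∀ ε > 0, ∃ F : H →L[ℂ] H, (F : H →ₗ[ℂ] H).HasFiniteRange ∧ ‖K - F‖ < ε

namespace ContinuousLinearMap

variable {H : Type*} [NormedAddCommGroup H] [NormedSpace ℂ H]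

lemma finiteRankApproximable_of_hasFiniteRange {K : H →L[ℂ] H}
    (hK : (K : H →ₗ[ℂ] H).HasFiniteRange) : K.FiniteRankApproximable :=
  fun ε hε => ⟨K, hK, by simpa using hε⟩

lemma FiniteRankApproximable.neg {K : H →L[ℂ] H} (hK : K.FiniteRankApproximable) :
    (-K).FiniteRankApproximable := fun ε hε => by
  obtain ⟨F, hF, h⟩ := hK ε hε
  refine ⟨-F, hF.neg, ?_⟩
  rwa [neg_sub_neg, norm_sub_rev]

lemma FiniteRankApproximable.mul_left {K : H →L[ℂ] H} (hK : K.FiniteRankApproximable)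
    (L : H →L[ℂ] H) : (L * K).FiniteRankApproximable := fun ε hε => by
  obtain ⟨F, hF, h⟩ := hK (ε / (‖L‖ + 1)) (by positivity)
  refine ⟨L * F, hF.comp_left _, ?_⟩
  rw [← mul_sub]
  have h1 : 0 < ‖L‖ + 1 := by positivity
  rw [lt_div_iff₀ h1] at h
  have h2 := norm_mul_le L (K - F)
  nlinarith [norm_nonneg (K - F)]

lemma FiniteRankApproximable.isCompactOperator [CompleteSpace H] {K : H →L[ℂ] H}
    (hK : K.FiniteRankApproximable) : IsCompactOperator K := by
  choose F hF h using fun n : ℕ => hK (1 / (n + 1 : ℝ)) (by positivity)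
  refine isCompactOperator_of_tendsto (l := atTop) (F := F) ?_ (.of_forall fun n => ?_)
  · rw [tendsto_iff_norm_sub_tendsto_zero]
    refine squeeze_zero (fun _ => norm_nonneg _) (fun n => ?_)
      tendsto_one_div_add_atTop_nhds_zero_nat
    rw [norm_sub_rev]
    exact (h n).le
  · have : FiniteDimensional ℂ (F n : H →ₗ[ℂ] H).range := Module.Finite.iff_fg.2 (hF n)
    have : ProperSpace (F n : H →ₗ[ℂ] H).range := FiniteDimensional.proper ℂ _
    exact (isCompactOperator_of_locallyCompactSpace_dom
      ((F n).codRestrict (F n : H →ₗ[ℂ] H).range fun x => LinearMap.mem_range_self _ x)).clm_comp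
      (F n : H →ₗ[ℂ] H).range.subtypeL

/-- With `v` a parametrix of `u` and `F` of finite rank close to `K`, the product `v * (u + K)` is
`1 + v * (K - F)` modulo finite rank. A Neumann series inverts that factor, and symmetrically on the
right. -/
lemma IsFredholm.add_finiteRankApproximable [CompleteSpace H] {u K : H →L[ℂ] H}
    (hu : u.IsFredholm) (hK : K.FiniteRankApproximable) : (u + K).IsFredholm := by
  obtain ⟨v, h₁, h₂⟩ := hu.exists_hasFiniteRange
  obtain ⟨F, hF, h⟩ := hK (1 / (‖v‖ + 1)) (by positivity)
  have h0 : 0 < ‖v‖ + 1 := by positivity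
  rw [lt_div_iff₀ h0] at h
  have hl : ‖-(v * (K - F))‖ < 1 := by
    rw [norm_neg]
    nlinarith [norm_mul_le v (K - F), norm_nonneg (K - F)]
  have hr : ‖-((K - F) * v)‖ < 1 := by
    rw [norm_neg]
    nlinarith [norm_mul_le (K - F) v, norm_nonneg (K - F)]
  obtain ⟨p, hp⟩ := isUnit_one_sub_of_norm_lt_one hl
  obtain ⟨q, hq⟩ := isUnit_one_sub_of_norm_lt_one hr
  have hp' : (↑p⁻¹ : H →L[ℂ] H) * (1 + v * (K - F)) = 1 := by
    rw [← sub_neg_eq_add, ← hp, Units.inv_mul]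
  have hq' : (1 + (K - F) * v) * (↑q⁻¹ : H →L[ℂ] H) = 1 := by
    rw [← sub_neg_eq_add, ← hq, Units.mul_inv]
  refine isFredholm_of_left_right (v₁ := ↑p⁻¹ * v) (v₂ := v * ↑q⁻¹) ?_ ?_
  · have e : (↑p⁻¹ * v) * (u + K) - 1 = ↑p⁻¹ * ((v * u - 1) + v * F) := by
      calc _ = (↑p⁻¹ * v) * (u + K) - ↑p⁻¹ * (1 + v * (K - F)) := by rw [hp']
        _ = _ := by noncomm_ring
    rw [e]
    exact (h₁.add (hF.comp_left (v : H →ₗ[ℂ] H))).comp_left _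
  · have e : (u + K) * (v * ↑q⁻¹) - 1 = ((u * v - 1) + F * v) * ↑q⁻¹ := by
      calc _ = (u + K) * (v * ↑q⁻¹) - (1 + (K - F) * v) * ↑q⁻¹ := by rw [hq']
        _ = _ := by noncomm_ring
    rw [e]
    exact (h₂.add (hF.comp_right (v : H →ₗ[ℂ] H))).comp_right _

lemma isFredholm_add_iff [CompleteSpace H] {u K : H →L[ℂ] H} (hK : K.FiniteRankApproximable) :
    (u + K).IsFredholm ↔ u.IsFredholm :=
  ⟨fun h => by simpa using h.add_finiteRankApproximable hK.neg,
    fun h => h.add_finiteRankApproximable hK⟩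

lemma isFredholm_of_isUnit {u : H →L[ℂ] H} (hu : IsUnit u) : u.IsFredholm := by
  obtain ⟨u, rfl⟩ := hu
  exact isFredholm_of_left_right (v₁ := ↑u⁻¹) (v₂ := ↑u⁻¹) (by simp) (by simp)

lemma IsFredholm.mul {u v : H →L[ℂ] H} (hu : u.IsFredholm) (hv : v.IsFredholm) :
    (u * v).IsFredholm := by
  obtain ⟨u', h₁, h₂⟩ := hu.exists_hasFiniteRange
  obtain ⟨v', h₃, h₄⟩ := hv.exists_hasFiniteRange
  refine isFredholm_of_left_right (v₁ := v' * u') (v₂ := v' * u') ?_ ?_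
  · have e : v' * u' * (u * v) - 1 = v' * ((u' * u - 1) * v) + (v' * v - 1) := by noncomm_ring
    rw [e]
    exact ((h₁.comp_right (v : H →ₗ[ℂ] H)).comp_left (v' : H →ₗ[ℂ] H)).add h₃
  · have e : u * v * (v' * u') - 1 = u * ((v * v' - 1) * u') + (u * u' - 1) := by noncomm_ring
    rw [e]
    exact ((h₄.comp_right (u' : H →ₗ[ℂ] H)).comp_left (u : H →ₗ[ℂ] H)).add h₂

lemma IsFredholm.conj {H' : Type*} [NormedAddCommGroup H'] [NormedSpace ℂ H'] (e : H ≃L[ℂ] H')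
    {u : H' →L[ℂ] H'} (hu : u.IsFredholm) :
    ((e.symm : H' →L[ℂ] H) ∘L u ∘L (e : H →L[ℂ] H')).IsFredholm := by
  obtain ⟨v, h₁, h₂⟩ := hu.exists_hasFiniteRange
  have key : ∀ s t : H' →L[ℂ] H', ((s * t - 1 : H' →L[ℂ] H') : H' →ₗ[ℂ] H').HasFiniteRange →
      ((((e.symm : H' →L[ℂ] H) ∘L s ∘L (e : H →L[ℂ] H')) *
        ((e.symm : H' →L[ℂ] H) ∘L t ∘L (e : H →L[ℂ] H')) - 1 : H →L[ℂ] H) :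
          H →ₗ[ℂ] H).HasFiniteRange := by
    intro s t hst
    have e1 : ((((e.symm : H' →L[ℂ] H) ∘L s ∘L (e : H →L[ℂ] H')) *
        ((e.symm : H' →L[ℂ] H) ∘L t ∘L (e : H →L[ℂ] H')) - 1 : H →L[ℂ] H) : H →ₗ[ℂ] H)
        = ((e.symm : H' →L[ℂ] H) : H' →ₗ[ℂ] H) ∘ₗ ((s * t - 1 : H' →L[ℂ] H') : H' →ₗ[ℂ] H') ∘ₗ
          ((e : H →L[ℂ] H') : H →ₗ[ℂ] H') := by
      ext x
      simp
    rw [e1]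
    exact (hst.comp_right _).comp_left _
  exact isFredholm_of_left_right (key v u h₁) (key u v h₂)

end ContinuousLinearMap

/-- The element `1 - x` is a factor of `1 - x ^ n`, with commuting cofactor the geometric sum.
Powers are needed because `n`-step ratios control the norm of the `n`-th power of a shift, not of
the shift itself. -/
lemma isUnit_one_sub_of_norm_pow_lt_one {A : Type*} [NormedRing A] [HasSummableGeomSeries A]
    {x : A} {n : ℕ} (h : ‖x ^ n‖ < 1) : IsUnit (1 - x) := by
  have h1 := isUnit_one_sub_of_norm_lt_one h
  rw [← mul_neg_geom_sum] at h1
  refine ((Commute.isUnit_mul_iff ?_).1 h1).1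
  exact (mul_neg_geom_sum x n).trans (geom_sum_mul_neg x n).symm

/-! ### Weighted composition operators on `ℓ²` -/

namespace SeqL2

lemma sum_sq_le_norm_sq (x : SeqL2) (s : Finset ℕ) : ∑ n ∈ s, ‖x n‖ ^ 2 ≤ ‖x‖ ^ 2 := by
  simpa using lp.sum_rpow_le_norm_rpow (p := 2) (by norm_num) x s

lemma norm_apply_le (x : SeqL2) (n : ℕ) : ‖x n‖ ≤ ‖x‖ :=
  lp.norm_apply_le_norm (by norm_num) x n

lemma norm_le_of_forall_sum_sq_le {C : ℝ} (hC : 0 ≤ C) {x : SeqL2}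
    (h : ∀ s : Finset ℕ, ∑ n ∈ s, ‖x n‖ ^ 2 ≤ C ^ 2) : ‖x‖ ≤ C :=
  lp.norm_le_of_forall_sum_le (p := 2) (by norm_num) hC (by simpa using h)

section Weighted

variable {w : ℕ → ℂ} {σ : ℕ → ℕ} {M : ℝ}

/-- Injectivity of `σ` matters only where the weight is nonzero. Forward shifts are thus covered:
truncated subtraction `m - n` fails to be injective only at indices where the weight can be set to
zero. -/
lemma sum_weighted_sq_le (hσ : Set.InjOn σ {n | w n ≠ 0}) (hw : ∀ n, ‖w n‖ ≤ M)
    (x : SeqL2) (s : Finset ℕ) : ∑ n ∈ s, ‖w n * x (σ n)‖ ^ 2 ≤ (M * ‖x‖) ^ 2 := by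
  classical
  calc ∑ n ∈ s, ‖w n * x (σ n)‖ ^ 2
      = ∑ n ∈ s with w n ≠ 0, ‖w n * x (σ n)‖ ^ 2 := by
        rw [Finset.sum_filter]
        refine Finset.sum_congr rfl fun n _ => ?_
        split_ifs with h
        · rfl
        · simp [not_not.1 h]
    _ ≤ ∑ n ∈ s with w n ≠ 0, M ^ 2 * ‖x (σ n)‖ ^ 2 := by
        refine Finset.sum_le_sum fun n _ => ?_
        rw [norm_mul, mul_pow]
        gcongr
        exact hw n
    _ = M ^ 2 * ∑ m ∈ (s.filter fun n => w n ≠ 0).image σ, ‖x m‖ ^ 2 := by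
        rw [Finset.sum_image (s := s.filter fun n => w n ≠ 0) (g := σ) (f := fun m => ‖x m‖ ^ 2)
          fun i hi j hj hij => hσ (Finset.mem_filter.1 hi).2 (Finset.mem_filter.1 hj).2 hij,
          Finset.mul_sum]
    _ ≤ M ^ 2 * ‖x‖ ^ 2 := by
        gcongr
        exact sum_sq_le_norm_sq x _
    _ = _ := by ring

/-- Boundedness of the weighted composition operators `x ↦ (w_n x_{σ(n)})_n`. -/
lemma exists_weighted (hσ : Set.InjOn σ {n | w n ≠ 0}) (hw : ∀ n, ‖w n‖ ≤ M) :
    ∃ T : SeqL2 →L[ℂ] SeqL2, ∀ x n, T x n = w n * x (σ n) := by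
  have hM : 0 ≤ M := (norm_nonneg _).trans (hw 0)
  let T₀ : SeqL2 →ₗ[ℂ] SeqL2 :=
    { toFun x := ⟨fun n => w n * x (σ n), memℓp_gen' (C := (M * ‖x‖) ^ 2) fun s => by
        simpa only [ENNReal.toReal_ofNat, Real.rpow_ofNat] using sum_weighted_sq_le hσ hw x s⟩
      map_add' x y := by ext n; exact mul_add (w n) (x (σ n)) (y (σ n))
      map_smul' c x := by ext n; exact mul_left_comm (w n) c (x (σ n)) }
  exact ⟨T₀.mkContinuous M fun x => norm_le_of_forall_sum_sq_le (by positivity)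
    fun s => sum_weighted_sq_le hσ hw x s, fun x n => rfl⟩

lemma norm_weighted_le {T : SeqL2 →L[ℂ] SeqL2} (hT : ∀ x n, T x n = w n * x (σ n))
    (hσ : Set.InjOn σ {n | w n ≠ 0}) (hw : ∀ n, ‖w n‖ ≤ M) : ‖T‖ ≤ M := by
  have hM : 0 ≤ M := (norm_nonneg _).trans (hw 0)
  refine T.opNorm_le_bound hM fun x => norm_le_of_forall_sum_sq_le (by positivity) fun s => ?_
  simpa only [hT] using sum_weighted_sq_le hσ hw x s

end Weighted

lemma hasFiniteRange_of_apply_eq_zero {T : SeqL2 →L[ℂ] SeqL2} (N : ℕ)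
    (hT : ∀ x n, N ≤ n → T x n = 0) : (T : SeqL2 →ₗ[ℂ] SeqL2).HasFiniteRange := by
  let p : (T : SeqL2 →ₗ[ℂ] SeqL2).range →ₗ[ℂ] (Fin N → ℂ) :=
    { toFun y i := (y : SeqL2) i
      map_add' _ _ := rfl
      map_smul' _ _ := rfl }
  have hp : Function.Injective p := by
    refine (injective_iff_map_eq_zero p).2 ?_
    rintro ⟨_, x, rfl⟩ h
    ext n
    rcases lt_or_ge n N with hn | hn
    · exact congrFun h ⟨n, hn⟩
    · exact hT x n hn
  exact Module.Finite.iff_fg.1 (Module.Finite.of_injective p hp)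

end SeqL2

/-! ### Geometric decay or growth -/

/-- A positive sequence whose sums over intervals are controlled by the values at the end points
decays uniformly geometrically or grows uniformly geometrically. -/
lemma geometric_dichotomy {v : ℕ → ℝ} (hv : ∀ n, 0 < v n) {C : ℝ}
    (hC : ∀ k l, k ≤ l → ∑ j ∈ Finset.Ico k l, v j ≤ C * (v k + v l)) :
    (∃ n θ, 1 ≤ n ∧ θ < 1 ∧ ∀ k, v (k + n) ≤ θ * v k) ∨
      ∃ n θ, 1 ≤ n ∧ 1 < θ ∧ ∀ k, θ * v k ≤ v (k + n) := by
  have hC0 : 0 < C := by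
    by_contra! h
    have h1 := hC 0 1 zero_le_one
    have h2 : 0 < v 0 + v 1 := add_pos (hv 0) (hv 1)
    simp only [Nat.Ico_succ_singleton, Finset.sum_singleton] at h1
    nlinarith [hv 0]
  by_cases hs : Summable v
  · left
    -- Letting the right end point go to infinity bounds the tail `t k` by `C * v k`. Removing the
    -- first term then shrinks the tail by the factor `1 - 1 / C`.
    let t : ℕ → ℝ := fun k => ∑' j, v (k + j)
    have hsk : ∀ k, Summable fun j => v (k + j) := fun k => by
      simpa only [add_comm] using (summable_nat_add_iff k).2 hs
    have ht : ∀ k, t k = v k + t (k + 1) := fun k => by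
      have := (hsk k).tsum_eq_zero_add
      simpa only [t, add_zero, add_assoc, add_comm, add_left_comm] using this
    have ht0 : ∀ k, 0 ≤ t k := fun k => tsum_nonneg fun j => (hv _).le
    have htC : ∀ k, t k ≤ C * v k := fun k => by
      have h1 : Tendsto (fun l => ∑ j ∈ Finset.range l, v (k + j)) atTop (𝓝 (t k)) :=
        (hsk k).hasSum.tendsto_sum_nat
      have h2 : Tendsto (fun l => C * (v k + v (k + l))) atTop (𝓝 (C * (v k + 0))) :=
        ((hsk k).tendsto_atTop_zero.const_add _).const_mul _
      rw [add_zero] at h2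
      refine le_of_tendsto_of_tendsto' h1 h2 fun l => ?_
      have := hC k (k + l) (by omega)
      rwa [Finset.sum_Ico_eq_sum_range, Nat.add_sub_cancel_left] at this
    have hC1 : 1 ≤ C := by
      have h1 := htC 0
      have h2 := ht 0
      have h3 := ht0 1
      have h4 := hv 0
      simp only [zero_add] at h2
      by_contra! h
      nlinarith
    set q : ℝ := 1 - 1 / C with hq
    have hq0 : 0 ≤ q := by
      rw [hq, sub_nonneg, div_le_one hC0]; exact hC1
    have hq1 : q < 1 := by rw [hq]; linarith [one_div_pos.2 hC0]
    have hstep : ∀ k, t (k + 1) ≤ q * t k := fun k => by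
      have h1 : t k / C ≤ v k := by rw [div_le_iff₀ hC0]; linarith [htC k]
      have h2 : q * t k = t k - t k / C := by rw [hq]; ring
      rw [h2]; linarith [ht k]
    have hpow : ∀ n k, t (k + n) ≤ q ^ n * t k := by
      intro n k
      induction n with
      | zero => simp
      | succ n ih =>
        calc t (k + (n + 1)) ≤ q * t (k + n) := hstep _
          _ ≤ q * (q ^ n * t k) := by gcongr
          _ = _ := by ring
    -- Passing from `v` to its tails and back costs a factor `C`, which `q ^ m` must absorb.
    obtain ⟨m, hm⟩ := exists_pow_lt_of_lt_one (one_div_pos.2 hC0) hq1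
    refine ⟨m + 1, q ^ (m + 1) * C, by omega, ?_, fun k => ?_⟩
    · rw [lt_div_iff₀ hC0] at hm
      rw [pow_succ]
      nlinarith [pow_nonneg hq0 m]
    · calc v (k + (m + 1)) ≤ t (k + (m + 1)) := by rw [ht]; linarith [ht0 (k + (m + 1) + 1)]
        _ ≤ q ^ (m + 1) * t k := hpow _ _
        _ ≤ q ^ (m + 1) * (C * v k) := by gcongr; exact htC k
        _ = _ := by ring
  · right
    let s : ℕ → ℝ := fun l => ∑ j ∈ Finset.range l, v j
    have hs_top : Tendsto s atTop atTop :=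
      (not_summable_iff_tendsto_nat_atTop_of_nonneg fun n => (hv n).le).1 hs
    -- Past `l₀` the term `C * v 0` is at most half of the partial sum, so it can be absorbed on the
    -- left, leaving `s l ≤ 2 * C * v l`.
    obtain ⟨l₀, hl₀⟩ := eventually_atTop.1 (hs_top.eventually_ge_atTop (2 * C * v 0))
    have hss : ∀ l, s (l + 1) = s l + v l := fun l => Finset.sum_range_succ _ _
    have hs0 : ∀ l, 0 ≤ s l := fun l => Finset.sum_nonneg fun j _ => (hv j).le
    have hsv : ∀ l, l₀ ≤ l → s l ≤ 2 * C * v l := fun l hl => by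
      have h1 := hC 0 l (Nat.zero_le _)
      rw [← Finset.range_eq_Ico] at h1
      have h2 := hl₀ l hl
      change s l ≤ _ at h1
      linarith
    have hmono : Monotone s := monotone_nat_of_le_succ fun l => by linarith [hss l, hv l]
    set p : ℝ := 1 + 1 / (2 * C) with hp
    have hp1 : 1 < p := by rw [hp]; linarith [one_div_pos.2 (mul_pos two_pos hC0)]
    have hstep : ∀ l, l₀ ≤ l → p * s l ≤ s (l + 1) := fun l hl => by
      have h1 : s l / (2 * C) ≤ v l := by
        rw [div_le_iff₀ (by positivity)]; linarith [hsv l hl]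
      have h2 : p * s l = s l + s l / (2 * C) := by rw [hp]; ring
      rw [h2, hss]; linarith
    have hpow : ∀ m l, l₀ ≤ l → p ^ m * s l ≤ s (l + m) := by
      intro m l hl
      induction m with
      | zero => simp
      | succ m ih =>
        calc p ^ (m + 1) * s l = p * (p ^ m * s l) := by ring
          _ ≤ p * s (l + m) := by gcongr
          _ ≤ _ := hstep _ (by omega)
    obtain ⟨m, hm⟩ := pow_unbounded_of_one_lt (2 * C) hp1
    -- The shift by `l₀ + 1` brings any `k` into the range of geometric growth, and `v k` into the
    -- partial sum. The remaining `m` steps outweigh the factor `2 * C`.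
    refine ⟨l₀ + 1 + m, p ^ m / (2 * C), by omega, ?_, fun k => ?_⟩
    · rwa [one_lt_div (by positivity)]
    · rw [div_mul_eq_mul_div, div_le_iff₀ (by positivity)]
      calc p ^ m * v k ≤ p ^ m * s (k + 1) := by gcongr; rw [hss]; linarith [hs0 k]
        _ ≤ p ^ m * s (k + l₀ + 1) := by gcongr; exact hmono (by omega)
        _ ≤ s (k + l₀ + 1 + m) := hpow _ _ (by omega)
        _ ≤ 2 * C * v (k + l₀ + 1 + m) := hsv _ (by omega)
        _ = v (k + (l₀ + 1 + m)) * (2 * C) := by rw [mul_comm]; congr 2; omega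

lemma norm_div_le_pow {a : ℕ → ℂ} (ha : ∀ n, a n ≠ 0) {M : ℝ}
    (hM : ∀ n, ‖a (n + 1) / a n‖ ≤ M) (i k : ℕ) : ‖a (k + i) / a k‖ ≤ M ^ i := by
  have hM0 : 0 ≤ M := (norm_nonneg _).trans (hM 0)
  induction i with
  | zero => simp [ha k]
  | succ i ih =>
    have e : a (k + (i + 1)) / a k = a (k + i + 1) / a (k + i) * (a (k + i) / a k) := by
      have := ha (k + i)
      rw [← add_assoc]
      field_simp
    rw [e, norm_mul, pow_succ']
    gcongr
    exact hM _

/-! ### Fredholmness of the weighted backward shift minus a scalar -/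

namespace IsWeightedBackwardShift

variable {a : ℕ → ℂ} {T : SeqL2 →L[ℂ] SeqL2} {M : ℝ} {μ : ℂ}

lemma isFredholm_sub_of_le (hT : IsWeightedBackwardShift (fun n => a n / a (n - 1)) T)
    (ha : ∀ n, a n ≠ 0) (hM : ∀ n, ‖a (n + 1) / a n‖ ≤ M) {n : ℕ} (hn : 1 ≤ n) {ρ : ℝ}
    (hρ : ∀ k, 1 ≤ k → ‖a (k + n) / a k‖ ≤ ρ) (hμ : ρ < ‖μ‖ ^ n) :
    (T - μ • ContinuousLinearMap.id ℂ SeqL2).IsFredholm := by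
  obtain ⟨j, rfl⟩ : ∃ j, n = j + 1 := ⟨n - 1, by omega⟩
  have hM0 : 0 ≤ M := (norm_nonneg _).trans (hM 0)
  have hρ0 : 0 ≤ ρ := (norm_nonneg _).trans (hρ 1 le_rfl)
  have hμ0 : μ ≠ 0 := by
    rintro rfl
    simp only [norm_zero, ne_eq, Nat.add_eq_zero_iff, one_ne_zero, and_false, not_false_eq_true,
      zero_pow] at hμ
    linarith
  -- The ratios are controlled only for `k ≥ 1`, so the weight at coordinate `0` is deleted. This
  -- changes `T` by finite rank and makes `ρ` a bound for `‖S ^ n‖`.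
  obtain ⟨S, hS⟩ := SeqL2.exists_weighted (w := fun m => if m = 0 then 0 else a (m + 1) / a m)
    (σ := (· + 1)) (M := M) (add_left_injective 1).injOn fun m => by
      split_ifs
      · simpa using hM0
      · exact hM m
  have hpow : ∀ i x m, (S ^ (i + 1)) x m
      = (if m = 0 then 0 else a (m + (i + 1)) / a m) * x (m + (i + 1)) := by
    intro i
    induction i with
    | zero => simpa using hS
    | succ i ih =>
      intro x m
      rw [pow_succ']
      change S ((S ^ (i + 1)) x) m = _
      rw [hS, ih]
      by_cases h : m = 0
      · simp [h]
      · have := ha (m + 1)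
        rw [if_neg h, if_neg h, if_neg (Nat.succ_ne_zero m), ← mul_assoc,
          show m + 1 + (i + 1) = m + (i + 1 + 1) by omega]
        field_simp
  have hnorm : ‖(μ⁻¹ • S) ^ (j + 1)‖ < 1 := by
    have h1 : ‖S ^ (j + 1)‖ ≤ ρ :=
      SeqL2.norm_weighted_le (σ := (· + (j + 1))) (hpow j) (add_left_injective _).injOn fun m => by
        split_ifs with h
        · simpa using hρ0
        · exact hρ m (by omega)
    have h2 : 0 < ‖μ‖ ^ (j + 1) := by positivity
    rw [smul_pow, norm_smul, norm_pow, norm_inv, inv_pow, inv_mul_lt_iff₀ h2, mul_one]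
    exact h1.trans_lt hμ
  have hunit : IsUnit ((-μ) • (1 - μ⁻¹ • S)) :=
    (isUnit_one_sub_of_norm_pow_lt_one hnorm).smul (Units.mk0 (-μ) (neg_ne_zero.2 hμ0))
  have hfin : ((T - S : SeqL2 →L[ℂ] SeqL2) : SeqL2 →ₗ[ℂ] SeqL2).HasFiniteRange := by
    refine SeqL2.hasFiniteRange_of_apply_eq_zero 1 fun x m hm => ?_
    have h1 : T x m = a (m + 1) / a m * x (m + 1) := hT x m
    have h2 := hS x m
    rw [if_neg (by omega), ← h1] at h2
    exact sub_eq_zero.2 h2.symm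
  have e : T - μ • ContinuousLinearMap.id ℂ SeqL2 = (-μ) • (1 - μ⁻¹ • S) + (T - S) := by
    rw [smul_sub, smul_smul, neg_mul, mul_inv_cancel₀ hμ0]
    change T - μ • 1 = _
    simp only [neg_smul, one_smul]
    abel
  rw [e]
  exact (ContinuousLinearMap.isFredholm_of_isUnit hunit).add_finiteRankApproximable
    (ContinuousLinearMap.finiteRankApproximable_of_hasFiniteRange hfin)

lemma isFredholm_sub_of_ge (hT : IsWeightedBackwardShift (fun n => a n / a (n - 1)) T)
    (ha : ∀ n, a n ≠ 0) (hM : ∀ n, ‖a (n + 1) / a n‖ ≤ M) {n : ℕ} (hn : 1 ≤ n) {ρ : ℝ}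
    (hρ : ∀ k, 1 ≤ k → ρ ≤ ‖a (k + n) / a k‖) (hμ : ‖μ‖ ^ n < ρ) :
    (T - μ • ContinuousLinearMap.id ℂ SeqL2).IsFredholm := by
  obtain ⟨j, rfl⟩ : ∃ j, n = j + 1 := ⟨n - 1, by omega⟩
  have hM0 : 0 ≤ M := (norm_nonneg _).trans (hM 0)
  have hρ0 : 0 < ρ := (by positivity : 0 ≤ ‖μ‖ ^ (j + 1)).trans_lt hμ
  -- A lower bound on `j + 1` consecutive steps and the upper bound `M` on the last `j` of them
  -- bound the first step from below.
  have hinv : ∀ k, 1 ≤ k → ‖a k / a (k + 1)‖ ≤ M ^ j / ρ := by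
    intro k hk
    have e : a k / a (k + 1) = a (k + 1 + j) / a (k + 1) / (a (k + (j + 1)) / a k) := by
      have h1 := ha (k + (j + 1))
      have h2 := ha k
      rw [show k + 1 + j = k + (j + 1) by omega]
      field_simp
    rw [e, norm_div]
    exact div_le_div₀ (by positivity) (norm_div_le_pow ha hM j (k + 1)) hρ0 (hρ k hk)
  have hσ : ∀ (n : ℕ) (w : ℕ → ℂ),
      Set.InjOn (fun m : ℕ => m - n) {m : ℕ | (if m ≤ n then 0 else w m) ≠ 0} := by
    intro n w p hp q hq hpq
    have h1 : ¬ p ≤ n := fun h => hp (if_pos h)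
    have h2 : ¬ q ≤ n := fun h => hq (if_pos h)
    dsimp only at hpq
    omega
  -- `R` inverts `T` modulo finite rank. Its weight at `m = 1` is dropped since it involves `a 0`,
  -- about which `hρ` says nothing.
  obtain ⟨R, hR⟩ := SeqL2.exists_weighted (w := fun m => if m ≤ 1 then 0 else a (m - 1) / a m)
    (σ := fun m => m - 1) (M := M ^ j / ρ) (hσ 1 _) fun m => by
      split_ifs with h
      · simp only [norm_zero]; positivity
      · have := hinv (m - 1) (by omega)
        rwa [Nat.sub_add_cancel (by omega)] at this
  have hpow : ∀ i x m, (R ^ (i + 1)) x m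
      = (if m ≤ i + 1 then 0 else a (m - (i + 1)) / a m) * x (m - (i + 1)) := by
    intro i
    induction i with
    | zero => simpa using hR
    | succ i ih =>
      intro x m
      rw [pow_succ']
      change R ((R ^ (i + 1)) x) m = _
      rw [hR, ih]
      by_cases h : m ≤ i + 1 + 1
      · rw [if_pos h]
        by_cases h1 : m ≤ 1
        · rw [if_pos h1]; simp
        · rw [if_pos (show m - 1 ≤ i + 1 by omega)]; simp
      · have := ha (m - 1)
        rw [if_neg h, if_neg (show ¬ m ≤ 1 by omega), if_neg (show ¬ m - 1 ≤ i + 1 by omega),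
          ← mul_assoc, show m - 1 - (i + 1) = m - (i + 1 + 1) by omega]
        field_simp
  have hnorm : ‖(μ • R) ^ (j + 1)‖ < 1 := by
    have h1 : ‖R ^ (j + 1)‖ ≤ 1 / ρ :=
      SeqL2.norm_weighted_le (σ := fun m => m - (j + 1)) (hpow j) (hσ (j + 1) _) fun m => by
        split_ifs with h
        · simp only [norm_zero]; positivity
        · have h2 := hρ (m - (j + 1)) (by omega)
          rw [Nat.sub_add_cancel (by omega)] at h2
          rw [← inv_div, norm_inv, ← one_div]
          exact one_div_le_one_div_of_le hρ0 h2
    rw [smul_pow, norm_smul, norm_pow]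
    calc ‖μ‖ ^ (j + 1) * ‖R ^ (j + 1)‖ ≤ ‖μ‖ ^ (j + 1) * (1 / ρ) := by gcongr
      _ < 1 := by rw [mul_one_div, div_lt_one hρ0]; exact hμ
  have hT' : ∀ x m, T x m = a (m + 1) / a m * x (m + 1) := hT
  have hTR : ((T * R - 1 : SeqL2 →L[ℂ] SeqL2) : SeqL2 →ₗ[ℂ] SeqL2).HasFiniteRange := by
    refine SeqL2.hasFiniteRange_of_apply_eq_zero 1 fun x m hm => ?_
    change T (R x) m - x m = 0
    have h1 := ha m
    have h2 := ha (m + 1)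
    rw [hT', hR, if_neg (by omega), Nat.add_sub_cancel]
    field_simp
    ring
  have hRT : ((R * T - 1 : SeqL2 →L[ℂ] SeqL2) : SeqL2 →ₗ[ℂ] SeqL2).HasFiniteRange := by
    refine SeqL2.hasFiniteRange_of_apply_eq_zero 2 fun x m hm => ?_
    change R (T x) m - x m = 0
    have h1 := ha m
    have h2 := ha (m - 1)
    rw [hR, hT', if_neg (by omega), Nat.sub_add_cancel (by omega)]
    field_simp
    ring
  have e : T - μ • ContinuousLinearMap.id ℂ SeqL2
      = T * (1 - μ • R) + μ • (T * R - 1) := by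
    rw [mul_sub, mul_one, mul_smul_comm, smul_sub]
    change T - μ • 1 = _
    abel
  rw [e]
  exact ((ContinuousLinearMap.isFredholm_of_left_right hRT hTR).mul
    (ContinuousLinearMap.isFredholm_of_isUnit
      (isUnit_one_sub_of_norm_pow_lt_one hnorm))).add_finiteRankApproximable
    (ContinuousLinearMap.finiteRankApproximable_of_hasFiniteRange (hTR.smul μ))

/-- The range contains every basis vector, hence is dense. For `μ ≠ 0` this is an induction starting
from `T e_0 = 0`: up to the factor `μ`, `e_{n+1}` is a multiple of `e_n` minus `(T - μ) e_{n+1}`. -/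
lemma surjective_of_isClosed_range (hT : IsWeightedBackwardShift (fun n => a n / a (n - 1)) T)
    (ha : ∀ n, a n ≠ 0)
    (hcl : IsClosed ((T - μ • ContinuousLinearMap.id ℂ SeqL2).range : Set SeqL2)) :
    Function.Surjective (T - μ • ContinuousLinearMap.id ℂ SeqL2) := by
  have hT' : ∀ x m, T x m = a (m + 1) / a m * x (m + 1) := hT
  have hmem : ∀ n c, lp.single (E := fun _ : ℕ => ℂ) 2 n c
      ∈ (T - μ • ContinuousLinearMap.id ℂ SeqL2).range := by
    have hsucc : ∀ n c, (T - μ • ContinuousLinearMap.id ℂ SeqL2) (lp.single 2 (n + 1) c)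
        = lp.single 2 n (a (n + 1) / a n * c) - μ • lp.single 2 (n + 1) c := by
      intro n c
      ext m
      change T (lp.single 2 (n + 1) c) m - μ * (lp.single 2 (n + 1) c : SeqL2) m
        = (lp.single 2 n (a (n + 1) / a n * c) : SeqL2) m - μ * (lp.single 2 (n + 1) c : SeqL2) m
      rw [hT']
      congr 1
      by_cases h : m = n
      · subst h; simp
      · simp [h]
    have hzero : ∀ c, (T - μ • ContinuousLinearMap.id ℂ SeqL2) (lp.single 2 0 c)
        = - μ • lp.single 2 0 c := by
      intro c
      ext m
      change T (lp.single 2 0 c) m - μ * (lp.single 2 0 c : SeqL2) m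
        = -μ * (lp.single 2 0 c : SeqL2) m
      rw [hT']
      simp
    by_cases hμ : μ = 0
    · subst hμ
      intro n c
      refine ⟨lp.single 2 (n + 1) (a n / a (n + 1) * c), ?_⟩
      refine (hsucc _ _).trans ?_
      have h1 := ha n
      have h2 := ha (n + 1)
      rw [zero_smul, sub_zero]
      congr 1
      field_simp
    · intro n
      induction n with
      | zero =>
        intro c
        have h1 := LinearMap.mem_range_self
          (T - μ • ContinuousLinearMap.id ℂ SeqL2 : SeqL2 →L[ℂ] SeqL2).toLinearMap
          (lp.single 2 0 c)
        have h2 := Submodule.smul_mem _ (-μ)⁻¹ h1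
        rw [ContinuousLinearMap.coe_coe, hzero, smul_smul,
          inv_mul_cancel₀ (neg_ne_zero.2 hμ), one_smul] at h2
        exact h2
      | succ n ih =>
        intro c
        have h1 := LinearMap.mem_range_self
          (T - μ • ContinuousLinearMap.id ℂ SeqL2 : SeqL2 →L[ℂ] SeqL2).toLinearMap
          (lp.single 2 (n + 1) c)
        rw [ContinuousLinearMap.coe_coe, hsucc] at h1
        have h2 := Submodule.smul_mem _ μ⁻¹ (Submodule.sub_mem _ (ih (a (n + 1) / a n * c)) h1)
        rwa [sub_sub_cancel, smul_smul, inv_mul_cancel₀ hμ, one_smul] at h2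
  intro y
  refine hcl.mem_of_tendsto (lp.hasSum_single (p := 2) (by norm_num) y)
    (.of_forall fun s => ?_)
  exact Submodule.sum_mem _ fun n _ => hmem n _

lemma exists_ratio_bounds_of_isFredholm_sub
    (hT : IsWeightedBackwardShift (fun n => a n / a (n - 1)) T) (ha : ∀ n, a n ≠ 0)
    (hF : (T - μ • ContinuousLinearMap.id ℂ SeqL2).IsFredholm) :
    (∃ n ρ, 1 ≤ n ∧ ρ < ‖μ‖ ^ n ∧ ∀ k, ‖a (k + n) / a k‖ ≤ ρ) ∨
      ∃ n ρ, 1 ≤ n ∧ ‖μ‖ ^ n < ρ ∧ ∀ k, ρ ≤ ‖a (k + n) / a k‖ := by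
  have hT' : ∀ x m, T x m = a (m + 1) / a m * x (m + 1) := hT
  obtain ⟨C, hC0, hC⟩ := ContinuousLinearMap.exists_preimage_norm_le _
    (hT.surjective_of_isClosed_range ha hF.isClosed_range)
  have hC' : ∀ y : SeqL2, ∃ x : SeqL2, (∀ m, a (m + 1) / a m * x (m + 1) - μ * x m = y m) ∧
      ‖x‖ ≤ C * ‖y‖ := by
    intro y
    obtain ⟨x, rfl, hx⟩ := hC y
    exact ⟨x, fun m => by rw [← hT']; rfl, hx⟩
  by_cases hμ : μ = 0
  · subst hμ
    -- Solving `T x = e_k` forces `x (k + 1)` to be the reciprocal of the weight, so its bound `C`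
    -- is a lower bound for the weight.
    refine Or.inr ⟨1, 1 / C, le_rfl, by simpa using hC0, fun k => ?_⟩
    obtain ⟨x, hx, hxC⟩ := hC' (lp.single 2 k 1)
    have h1 := hx k
    rw [lp.norm_single (by norm_num)] at hxC
    simp only [zero_mul, sub_zero, lp.single_apply_self] at h1
    have h2 : ‖a (k + 1) / a k‖ * ‖x (k + 1)‖ = 1 := by rw [← norm_mul, h1, norm_one]
    have h3 := SeqL2.norm_apply_le x (k + 1)
    rw [div_le_iff₀ hC0, ← h2]
    gcongr
    simpa using h3.trans hxC
  · have hμ0 : 0 < ‖μ‖ := norm_pos_iff.2 hμ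
    -- Since `t j * (a (j + 1) / a j) = μ * t (j + 1)`, pairing `(T - μ) x` with `t` over an
    -- interval leaves only boundary terms.
    set t : ℕ → ℂ := fun j => a j / μ ^ j with ht
    have ht0 : ∀ j, 0 < ‖t j‖ := fun j =>
      norm_pos_iff.2 (div_ne_zero (ha j) (pow_ne_zero _ hμ))
    have hratio : ∀ k n, ‖a (k + n) / a k‖ = ‖t (k + n)‖ / ‖t k‖ * ‖μ‖ ^ n := by
      intro k n
      rw [← norm_div, ← norm_pow, ← norm_mul]
      have h1 := ha k
      simp only [ht, pow_add]
      congr 1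
      field_simp
    have hsum : ∀ k l, k ≤ l → ∑ j ∈ Finset.Ico k l, ‖t j‖ ^ 2
        ≤ (2 * (C * ‖μ‖) ^ 2) * (‖t k‖ ^ 2 + ‖t l‖ ^ 2) := by
      intro k l hkl
      set V := ∑ j ∈ Finset.Ico k l, ‖t j‖ ^ 2 with hV
      have hV0 : 0 ≤ V := Finset.sum_nonneg fun j _ => by positivity
      -- The extremal test vector: its pairing with `t` is `V = ‖z‖ ^ 2`, while telescoping bounds
      -- that pairing linearly in `‖z‖`.
      set z : SeqL2 := ∑ j ∈ Finset.Ico k l, lp.single 2 j (conj (t j)) with hz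
      have hzj : ∀ j ∈ Finset.Ico k l, z j = conj (t j) := by
        intro j hj
        rw [hz, lp.coeFn_sum, Finset.sum_apply, Finset.sum_eq_single j]
        · simp
        · intro i _ hij
          simp [hij.symm]
        · exact fun h => absurd hj h
      have hznorm : ‖z‖ ^ 2 = V := by
        have := lp.norm_sum_single (p := 2) (E := fun _ : ℕ => ℂ) (by norm_num)
          (fun j => conj (t j)) (Finset.Ico k l)
        simpa using this
      obtain ⟨x, hx, hxC⟩ := hC' z
      have htel : ∑ j ∈ Finset.Ico k l, t j * z j = μ * (t l * x l - t k * x k) := by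
        have h1 : ∀ j, t j * (a (j + 1) / a j * x (j + 1) - μ * x j)
            = μ * (t (j + 1) * x (j + 1)) - μ * (t j * x j) := by
          intro j
          have h1 := ha j
          simp only [ht, pow_succ]
          field_simp
        simp only [← hx, h1]
        rw [Finset.sum_Ico_sub (fun j => μ * (t j * x j)) hkl]
        ring
      have hV2 : (V : ℂ) = ∑ j ∈ Finset.Ico k l, t j * z j := by
        rw [hV]
        push_cast
        exact Finset.sum_congr rfl fun j hj => by rw [hzj j hj, Complex.mul_conj']
      have h1 : V ≤ ‖μ‖ * ((‖t l‖ + ‖t k‖) * (C * ‖z‖)) := by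
        calc V = ‖(V : ℂ)‖ := by rw [Complex.norm_real, Real.norm_of_nonneg hV0]
          _ = ‖μ‖ * ‖t l * x l - t k * x k‖ := by rw [hV2, htel, norm_mul]
          _ ≤ ‖μ‖ * (‖t l‖ * ‖x l‖ + ‖t k‖ * ‖x k‖) := by
            gcongr
            exact (norm_sub_le _ _).trans (by rw [norm_mul, norm_mul])
          _ ≤ ‖μ‖ * (‖t l‖ * (C * ‖z‖) + ‖t k‖ * (C * ‖z‖)) := by
            gcongr
            · exact (SeqL2.norm_apply_le x l).trans hxC
            · exact (SeqL2.norm_apply_le x k).trans hxC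
          _ = _ := by ring
      have h2 : ‖z‖ ≤ C * ‖μ‖ * (‖t l‖ + ‖t k‖) := by
        rcases (norm_nonneg z).eq_or_lt with h | h
        · rw [← h]; positivity
        · rw [← hznorm] at h1
          refine le_of_mul_le_mul_right ?_ h
          linarith
      calc V = ‖z‖ ^ 2 := hznorm.symm
        _ ≤ (C * ‖μ‖ * (‖t l‖ + ‖t k‖)) ^ 2 := by gcongr
        _ = (C * ‖μ‖) ^ 2 * (‖t l‖ + ‖t k‖) ^ 2 := by ring
        _ ≤ (C * ‖μ‖) ^ 2 * (2 * (‖t k‖ ^ 2 + ‖t l‖ ^ 2)) := by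
          gcongr
          linarith [sq_nonneg (‖t l‖ - ‖t k‖)]
        _ = _ := by ring
    rcases geometric_dichotomy (v := fun j => ‖t j‖ ^ 2) (fun j => pow_pos (ht0 j) 2) hsum with
      ⟨n, θ, hn, hθ, h⟩ | ⟨n, θ, hn, hθ, h⟩
    -- The square root appears because the dichotomy was applied to `‖t j‖ ^ 2`.
    · refine Or.inl ⟨n, √θ * ‖μ‖ ^ n, hn, ?_, fun k => ?_⟩
      · exact mul_lt_of_lt_one_left (by positivity) ((Real.sqrt_lt' one_pos).2 (by simpa using hθ))
      · rw [hratio]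
        gcongr
        refine Real.le_sqrt_of_sq_le ?_
        rw [div_pow, div_le_iff₀ (pow_pos (ht0 k) 2)]
        exact h k
    · refine Or.inr ⟨n, √θ * ‖μ‖ ^ n, hn, ?_, fun k => ?_⟩
      · exact lt_mul_of_one_lt_left (by positivity) (Real.lt_sqrt_of_sq_lt (by simpa using hθ))
      · rw [hratio]
        gcongr
        refine Real.sqrt_le_iff.2 ⟨by positivity, ?_⟩
        rw [div_pow, le_div_iff₀ (pow_pos (ht0 k) 2)]
        exact h k

end IsWeightedBackwardShift

/-! ### The compact correction term -/

namespace SeqL2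

lemma exists_diagonal_finiteRankApproximable {c : ℕ → ℂ} (hc : Tendsto c atTop (𝓝 0)) :
    ∃ D : SeqL2 →L[ℂ] SeqL2, (∀ x n, D x n = c n * x n) ∧ D.FiniteRankApproximable := by
  obtain ⟨M, hM⟩ := hc.norm.bddAbove_range
  obtain ⟨D, hD⟩ := exists_weighted (σ := id) Function.injective_id.injOn
    fun n => hM (Set.mem_range_self n)
  refine ⟨D, hD, fun ε hε => ?_⟩
  obtain ⟨N, hN⟩ := Metric.tendsto_atTop.1 hc (ε / 2) (by positivity)
  obtain ⟨F, hF⟩ := exists_weighted (w := fun n => if n < N then c n else 0) (M := M) (σ := id)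
    Function.injective_id.injOn fun n => by
      split_ifs
      · exact hM (Set.mem_range_self n)
      · simpa using (norm_nonneg _).trans (hM (Set.mem_range_self 0))
  refine ⟨F, hasFiniteRange_of_apply_eq_zero N fun x n hn => ?_, ?_⟩
  · rw [hF, if_neg (by omega), zero_mul]
  · refine (norm_weighted_le (w := fun n => if n < N then 0 else c n) (σ := id) (M := ε / 2)
      (fun x n => ?_) Function.injective_id.injOn fun n => ?_).trans_lt (by linarith)
    · change D x n - F x n = _
      rw [hD, hF]
      split_ifs <;> simp
    · split_ifs with h
      · rw [norm_zero]; positivity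
      · simpa using (hN n (by omega)).le

/-- If `F` is a weighted forward shift whose weights satisfy `limsup |β_n| < 1`, then `1 + F` is
invertible. -/
lemma exists_forwardShift_isUnit_one_add {β : ℕ → ℂ}
    (hβ : limsup (fun n => ‖β n‖ₑ) atTop < 1) :
    ∃ F : SeqL2 →L[ℂ] SeqL2, (∀ x, F x 0 = 0) ∧ (∀ x n, F x (n + 1) = β n * x n) ∧
      IsUnit (1 + F) := by
  obtain ⟨r, hr, hr1⟩ := exists_between hβ
  lift r to ℝ≥0 using hr1.ne_top
  obtain ⟨N, hN⟩ := eventually_atTop.1 (eventually_lt_of_limsup_lt hr)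
  have hr1' : (r : ℝ) < 1 := by exact_mod_cast hr1
  have hNr : ∀ n, N ≤ n → ‖β n‖ ≤ r := fun n hn => by
    have := (hN n hn).le
    rw [enorm_le_coe] at this
    exact_mod_cast this
  have hσ : ∀ w : ℕ → ℂ,
      Set.InjOn (fun m : ℕ => m - 1) {m : ℕ | (if m = 0 then 0 else w m) ≠ 0} := by
    intro w p hp q hq hpq
    have h1 : ¬ p = 0 := fun h => hp (if_pos h)
    have h2 : ¬ q = 0 := fun h => hq (if_pos h)
    dsimp only at hpq
    omega
  -- Split the shift into a tail `S` of norm at most `r < 1` and a nilpotent head `R`. The output of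
  -- `S` starts beyond the coordinates read by `R`, so `R * S = 0` and `1 + R + S = (1 + R) * (1 +
  -- S)`.
  obtain ⟨S, hS⟩ := exists_weighted (M := r) (σ := fun m => m - 1)
    (hσ fun m => if m ≤ N then 0 else β (m - 1)) fun m => by
      split_ifs
      · simp
      · simp
      · exact hNr _ (by omega)
  obtain ⟨R, hR⟩ := exists_weighted (M := ∑ i ∈ Finset.range N, ‖β i‖) (σ := fun m => m - 1)
    (hσ fun m => if m ≤ N then β (m - 1) else 0) fun m => by
      split_ifs
      · simpa using Finset.sum_nonneg fun i _ => norm_nonneg (β i)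
      · exact Finset.single_le_sum (f := fun i => ‖β i‖) (fun i _ => norm_nonneg (β i))
          (Finset.mem_range.2 (by omega))
      · simpa using Finset.sum_nonneg fun i _ => norm_nonneg (β i)
  have hSnorm : ‖S‖ ≤ r := norm_weighted_le hS (hσ _) fun m => by
      split_ifs
      · simp
      · simp
      · exact hNr _ (by omega)
  have hSunit : IsUnit (1 + S) := by
    rw [← sub_neg_eq_add]
    exact isUnit_one_sub_of_norm_lt_one (by rw [norm_neg]; exact hSnorm.trans_lt hr1')
  have hRpow : ∀ i x m, m < i → (R ^ i) x m = 0 := by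
    intro i
    induction i with
    | zero => intro x m h; omega
    | succ i ih =>
      intro x m h
      rw [pow_succ']
      change R ((R ^ i) x) m = 0
      rw [hR]
      by_cases hm : m = 0
      · simp [hm]
      · rw [ih x (m - 1) (by omega), mul_zero]
  have hRnil : IsNilpotent R := by
    refine ⟨N + 1, ?_⟩
    ext x m
    change ((R ^ (N + 1)) x) m = 0
    by_cases hm : m < N + 1
    · exact hRpow _ x m hm
    · rw [pow_succ']
      change R ((R ^ N) x) m = 0
      rw [hR, if_neg (show ¬ m = 0 by omega), if_neg (show ¬ m ≤ N by omega), zero_mul]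
  have hRS : R * S = 0 := by
    ext x m
    change R (S x) m = 0
    rw [hR, hS]
    by_cases hm : m = 0
    · simp [hm]
    · by_cases hm' : m ≤ N
      · by_cases hm1 : m - 1 = 0
        · simp [hm1]
        · rw [if_neg hm1, if_pos (show m - 1 ≤ N by omega), zero_mul, mul_zero]
      · rw [if_neg hm, if_neg hm', zero_mul]
  refine ⟨R + S, fun x => ?_, fun x n => ?_, ?_⟩
  · change R x 0 + S x 0 = 0
    rw [hR, hS]
    simp
  · change R x (n + 1) + S x (n + 1) = _
    rw [hR, hS, if_neg (Nat.succ_ne_zero n), if_neg (Nat.succ_ne_zero n), Nat.add_sub_cancel]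
    split_ifs <;> simp
  · have e : 1 + (R + S) = (1 + R) * (1 + S) := by
      rw [add_mul, one_mul, mul_add, mul_one, hRS, add_zero]
      abel
    rw [e]
    exact hRnil.isUnit_one_add.mul hSunit

end SeqL2

lemma exists_isWeightedBackwardShift {a : ℕ → ℂ} {M : ℝ} (hM : ∀ n, ‖a (n + 1) / a n‖ ≤ M) :
    ∃ T : SeqL2 →L[ℂ] SeqL2, IsWeightedBackwardShift (fun n => a n / a (n - 1)) T :=
  SeqL2.exists_weighted (w := fun n => a (n + 1) / a n) (σ := (· + 1))
    (add_left_injective 1).injOn hM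

/-- The operator `B_w + K` representing the backward shift in the basis `(f_n)`: it shifts the
Taylor coefficients of `∑ c_n f_n`. -/
lemma exists_finiteRankApproximable_taylorSeq_shift {a b : ℕ → ℂ} (ha : ∀ n, a n ≠ 0)
    (h_limsup : limsup (fun n : ℕ => ‖b n / a (n + 1)‖ₑ) atTop < 1)
    (h_diff : Tendsto (fun n : ℕ => b (n + 1) / a (n + 1) - b n / a n) atTop (𝓝 0))
    {T : SeqL2 →L[ℂ] SeqL2} (hT : IsWeightedBackwardShift (fun n => a n / a (n - 1)) T) :
    ∃ K : SeqL2 →L[ℂ] SeqL2, K.FiniteRankApproximable ∧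
      ∀ (c : SeqL2) n, IsTridiagonalPair.taylorSeq a b ((T + K) c) n
        = IsTridiagonalPair.taylorSeq a b c (n + 1) := by
  -- The coefficient identity for `T c + y` reads `y (n + 1) + b n / a (n + 1) * y n = (b (n + 1) /
  -- a (n + 1) - b n / a n) * c (n + 1)`. At index `0` there is no preceding term, whence the entry
  -- `b 0 / a 0`.
  obtain ⟨D, hD, hDapp⟩ := SeqL2.exists_diagonal_finiteRankApproximable
    (c := fun n => if n = 0 then b 0 / a 0 else b n / a n - b (n - 1) / a (n - 1)) (by
      refine (tendsto_add_atTop_iff_nat 1).1 ?_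
      simpa using h_diff)
  obtain ⟨F, hF0, hF, L, hL⟩ := SeqL2.exists_forwardShift_isUnit_one_add h_limsup
  refine ⟨↑L⁻¹ * D, hDapp.mul_left _, fun c n => ?_⟩
  have hT' : ∀ m, T c m = a (m + 1) / a m * c (m + 1) := hT c
  set y : SeqL2 := (↑L⁻¹ * D : SeqL2 →L[ℂ] SeqL2) c with hy
  have hyD : y + F y = D c := by
    have h1 : (L : SeqL2 →L[ℂ] SeqL2) * (↑L⁻¹ * D) = D := Units.mul_inv_cancel_left L D
    rw [hL] at h1
    exact DFunLike.congr_fun h1 c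
  have hyn : ∀ m, y m + F y m = D c m := fun m => by rw [← hyD]; rfl
  have hsum : ∀ m, (T + (↑L⁻¹ * D : SeqL2 →L[ℂ] SeqL2)) c m = T c m + y m := fun m => rfl
  cases n with
  | zero =>
    have h1 := hyn 0
    rw [hF0, hD, if_pos rfl, add_zero] at h1
    simp only [IsTridiagonalPair.taylorSeq, hsum, hT', h1]
    have := ha 0
    field_simp
  | succ n =>
    have h1 := hyn (n + 1)
    rw [hF, hD, if_neg (Nat.succ_ne_zero n), Nat.add_sub_cancel] at h1
    simp only [IsTridiagonalPair.taylorSeq, hsum, hT', eq_sub_of_add_eq h1]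
    have := ha n
    have := ha (n + 1)
    field_simp
    ring

/-! ### The annulus and the conclusion -/

namespace IsWeightedBackwardShift

lemma essentialSpectrum_eq_annulus {a : ℕ → ℂ} {T : SeqL2 →L[ℂ] SeqL2}
    (hT : IsWeightedBackwardShift (fun n => a n / a (n - 1)) T) (ha : ∀ n, a n ≠ 0) {M : ℝ}
    (hM : ∀ n, ‖a (n + 1) / a n‖ ≤ M) :
    essentialSpectrum T =
      {z : ℂ |
        (⨆ n : ℕ+, (⨅ k : ℕ+, ‖a (k + n) / a k‖) ^ (1 / (n : ℝ))) ≤ ‖z‖ ∧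
        ‖z‖ ≤ ⨅ n : ℕ+, (⨆ k : ℕ+, ‖a (k + n) / a k‖) ^ (1 / (n : ℝ))} := by
  have hM0 : 0 ≤ M := (norm_nonneg _).trans (hM 0)
  have hbdd : ∀ n : ℕ+, BddAbove (Set.range fun k : ℕ+ => ‖a (k + n) / a k‖) := fun n =>
    ⟨M ^ (n : ℕ), by rintro _ ⟨k, rfl⟩; exact norm_div_le_pow ha hM n k⟩
  have hbdd' : ∀ n : ℕ+, BddBelow (Set.range fun k : ℕ+ => ‖a (k + n) / a k‖) := fun n =>
    ⟨0, by rintro _ ⟨k, rfl⟩; exact norm_nonneg _⟩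
  have hsup0 : ∀ n : ℕ+, 0 ≤ ⨆ k : ℕ+, ‖a (k + n) / a k‖ := fun n =>
    Real.iSup_nonneg fun k => norm_nonneg _
  have hinf0 : ∀ n : ℕ+, 0 ≤ ⨅ k : ℕ+, ‖a (k + n) / a k‖ := fun n =>
    Real.iInf_nonneg fun k => norm_nonneg _
  have hn0 : ∀ n : ℕ+, 0 < (n : ℝ) := fun n => by exact_mod_cast n.pos
  have hinfbdd : BddAbove (Set.range fun n : ℕ+ =>
      (⨅ k : ℕ+, ‖a (k + n) / a k‖) ^ (1 / (n : ℝ))) := by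
    refine ⟨M, ?_⟩
    rintro _ ⟨n, rfl⟩
    dsimp only
    rw [one_div, Real.rpow_inv_le_iff_of_pos (hinf0 n) hM0 (hn0 n), Real.rpow_natCast]
    exact (ciInf_le (hbdd' n) 1).trans (norm_div_le_pow ha hM n _)
  have hsupbdd : BddBelow (Set.range fun n : ℕ+ =>
      (⨆ k : ℕ+, ‖a (k + n) / a k‖) ^ (1 / (n : ℝ))) := by
    refine ⟨0, ?_⟩
    rintro _ ⟨n, rfl⟩
    exact Real.rpow_nonneg (hsup0 n) _
  ext z
  simp only [essentialSpectrum, Set.mem_ofPred_eq]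
  -- Complements are compared: a point is off the annulus exactly when a single `n` witnesses a
  -- strict inequality for the infimum or supremum over `k`.
  rw [← not_iff_not, not_not]
  constructor
  · intro hF ⟨h1, h2⟩
    rcases hT.exists_ratio_bounds_of_isFredholm_sub ha hF with
      ⟨n, ρ, hn, hρ, h⟩ | ⟨n, ρ, hn, hρ, h⟩
    · lift n to ℕ+ using hn
      have h3 := h2.trans (ciInf_le hsupbdd n)
      rw [one_div, Real.le_rpow_inv_iff_of_pos (norm_nonneg z) (hsup0 n) (hn0 n),
        Real.rpow_natCast] at h3
      exact absurd (h3.trans (ciSup_le fun k : ℕ+ => h k)) hρ.not_ge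
    · lift n to ℕ+ using hn
      have h3 := (le_ciSup hinfbdd n).trans h1
      rw [one_div, Real.rpow_inv_le_iff_of_pos (hinf0 n) (norm_nonneg z) (hn0 n),
        Real.rpow_natCast] at h3
      exact absurd ((le_ciInf fun k : ℕ+ => h k).trans h3) hρ.not_ge
  · intro h
    rw [not_and_or, not_le, not_le] at h
    rcases h with h | h
    · obtain ⟨n, hn⟩ := exists_lt_of_lt_ciSup h
      rw [one_div, Real.lt_rpow_inv_iff_of_pos (norm_nonneg z) (hinf0 n) (hn0 n),
        Real.rpow_natCast] at hn
      exact hT.isFredholm_sub_of_ge ha hM n.pos (fun k hk => ciInf_le (hbdd' n) ⟨k, hk⟩) hn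
    · obtain ⟨n, hn⟩ := exists_lt_of_ciInf_lt h
      rw [one_div, Real.rpow_inv_lt_iff_of_pos (hsup0 n) (norm_nonneg z) (hn0 n),
        Real.rpow_natCast] at hn
      exact hT.isFredholm_sub_of_le ha hM n.pos
        (fun k hk => le_ciSup (f := fun k : ℕ+ => ‖a (k + n) / a k‖) (hbdd n) ⟨k, hk⟩) hn

end IsWeightedBackwardShift

lemma essentialSpectrum_add_finiteRankApproximable {H : Type*} [NormedAddCommGroup H]
    [InnerProductSpace ℂ H] [CompleteSpace H] (T : H →L[ℂ] H) {K : H →L[ℂ] H}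
    (hK : K.FiniteRankApproximable) : essentialSpectrum (T + K) = essentialSpectrum T := by
  ext μ
  rw [essentialSpectrum, essentialSpectrum, Set.mem_ofPred_eq, Set.mem_ofPred_eq,
    add_sub_right_comm, ContinuousLinearMap.isFredholm_add_iff hK]

lemma essentialSpectrum_conj {H H' : Type*} [NormedAddCommGroup H] [InnerProductSpace ℂ H]
    [NormedAddCommGroup H'] [InnerProductSpace ℂ H'] (e : H ≃L[ℂ] H') (T : H' →L[ℂ] H') :
    essentialSpectrum ((e.symm : H' →L[ℂ] H) ∘L T ∘L (e : H →L[ℂ] H')) = essentialSpectrum T := by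
  ext μ
  refine not_congr ⟨fun h => ?_, fun h => ?_⟩
  · have h1 := h.conj e.symm
    convert h1 using 1
    ext x
    simp
  · have h1 := h.conj e
    convert h1 using 1
    ext x
    simp

theorem theorem3p1 (a b : ℕ → ℂ) (h : IsTridiagonalPair a b)
    (h_ratio : BddAbove (Set.range fun n : ℕ => ‖a (n + 1) / a n‖))
    (h_limsup : limsup (fun n : ℕ => ‖b n / a (n + 1)‖ₑ) atTop < 1)
    (h_diff : Tendsto (fun n : ℕ => b (n + 1) / a (n + 1) - b n / a n) atTop (𝓝 0)) :
    ∃ B : TridiagonalSpace h →L[ℂ] TridiagonalSpace h,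
      (∀ f : TridiagonalSpace h, IsCoeffBackwardShift f (B f)) ∧
      (∃ (U : TridiagonalSpace h ≃ₗᵢ[ℂ] SeqL2) (Bw K : SeqL2 →L[ℂ] SeqL2),
        IsWeightedBackwardShift (fun n : ℕ => a n / a (n - 1)) Bw ∧
        IsCompactOperator K ∧
        ∀ f : TridiagonalSpace h, U (B f) = (Bw + K) (U f)) ∧
      essentialSpectrum B =
        {z : ℂ |
          (⨆ n : ℕ+, (⨅ k : ℕ+, ‖a (k + n) / a k‖) ^ (1 / (n : ℝ))) ≤ ‖z‖ ∧
          ‖z‖ ≤ ⨅ n : ℕ+, (⨆ k : ℕ+, ‖a (k + n) / a k‖) ^ (1 / (n : ℝ))} := by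
  obtain ⟨M, hM⟩ := h_ratio
  have hM' : ∀ n, ‖a (n + 1) / a n‖ ≤ M := fun n => hM (Set.mem_range_self n)
  obtain ⟨T, hT⟩ := exists_isWeightedBackwardShift hM'
  obtain ⟨K, hK, hshift⟩ :=
    exists_finiteRankApproximable_taylorSeq_shift h.a_ne_zero h_limsup h_diff hT
  let U : TridiagonalSpace h ≃ₗᵢ[ℂ] SeqL2 := (TridiagonalSpace.basis h).repr
  have hU : ∀ f : TridiagonalSpace h, h.synthesis (U f) = f := fun f =>
    congrArg Subtype.val ((TridiagonalSpace.coordEquiv h).symm_apply_apply f)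
  let e : TridiagonalSpace h ≃L[ℂ] SeqL2 := U.toContinuousLinearEquiv
  -- `B` is defined by transporting `T + K` to the function space. That it shifts Taylor
  -- coefficients is then `hshift`.
  let B : TridiagonalSpace h →L[ℂ] TridiagonalSpace h :=
    (e.symm : SeqL2 →L[ℂ] TridiagonalSpace h) ∘L (T + K) ∘L (e : TridiagonalSpace h →L[ℂ] SeqL2)
  have hB : ∀ f, U (B f) = (T + K) (U f) := fun f => U.apply_symm_apply _
  refine ⟨B, fun f => ⟨IsTridiagonalPair.taylorSeq a b (U f), fun z => ?_, fun z => ?_⟩,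
    ⟨U, T, K, hT, hK.isCompactOperator, hB⟩, ?_⟩
  · rw [← hU f]
    exact h.hasSum_taylorSeq (U f) z
  · have h1 := h.hasSum_taylorSeq (U (B f)) z
    rw [hU, hB] at h1
    simpa only [hshift] using h1
  · rw [essentialSpectrum_conj, essentialSpectrum_add_finiteRankApproximable T hK]
    exact hT.essentialSpectrum_eq_annulus h.a_ne_zero hM'
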